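/- For a positive integer $k$ let $H_k=\sum_{m=1}^{k}\frac1m$ be the $k$-th harmonic number, and let $\zeta$ be the Riemann zeta function. Then, as $k\to\infty$ through the positive integers, $$\sum_{1\le m_1,m_2,m_3\le k}\frac{1}{(m_1+m_2)(m_2+m_3)(m_3+m_1)}=\frac32\,\zeta(2)\,H_k-\frac{41}{8}\,\zeta(3)+O\!\left(\frac{(\log k)^3}{k}\right),$$ where the sum runs over all triples of positive integers $(m_1,m_2,m_3)$ with each $m_i\le k$, and the constant implied by $O$ is absolute. -/

import Mathlib

open Asymptotics Filter

/-! Partial fractions in `m₃` turn the summand, for `a ≠ b`, into `(1/(a+c) - 1/(b+c)) / (b² - a²)`.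
Summing over `c` gives differences `H_{a+k} - H_a`; antisymmetry in `a`, `b` then leaves the inner
sum `∑_b 1/(b² - a²)`, which is again explicit in harmonic numbers. This gives an exact identity
(`sum_cube_eq`): the cube sum is `3/2 ∑ (H_{a+k} - H_a)/a² - harmSum k + 1/2 tornheimSum k`.

Up to `O(log k / k)`, the first sum is `ζ(2) H_k - eulerSum k`. Symmetrising the Tornheim sum gives
half the Euler sum, while interchanging summation gives the Euler sum minus `ζ(3)`; hence `eulerSum
→ 2ζ(3)` and `tornheimSum → ζ(3)`.

`harmSum k` behaves like a Riemann sum for `∫₀¹ log((1+x)/(1-x)) log((1+x)/x) dx/x = 21/8 ζ(3)`,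
with error `O(log² k / k)` (`abs_harmSum_sub_le`). The constant is thus `-3 - 21/8 + 1/2 = -41/8`.
The argument yields `log²` in the error, stronger than the stated `log³`. -/

/-! ### Harmonic sums and the exact identity for the cube sum. -/

/-- The harmonic numbers, as real numbers. -/
noncomputable def harm (n : ℕ) : ℝ := ∑ m ∈ Finset.Icc 1 n, 1 / (m : ℝ)

theorem harm_zero : harm 0 = 0 := by simp [harm]

theorem harm_succ (n : ℕ) : harm (n + 1) = harm n + 1 / ((n : ℝ) + 1) := by
  rw [harm, Finset.sum_Icc_succ_top (by omega)]
  simp [harm]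

theorem harm_mono : Monotone harm :=
  monotone_nat_of_le_succ fun n => by
    rw [harm_succ]
    have : (0 : ℝ) ≤ 1 / ((n : ℝ) + 1) := by positivity
    linarith

theorem harm_nonneg (n : ℕ) : 0 ≤ harm n := by
  unfold harm; positivity

theorem sum_inv_add_eq_harm_sub (a k : ℕ) :
    ∑ c ∈ Finset.Icc 1 k, 1 / ((a : ℝ) + c) = harm (a + k) - harm a := by
  induction k with
  | zero => simp
  | succ k ih =>
    rw [Finset.sum_Icc_succ_top (by omega), ih, ← add_assoc, harm_succ]
    push_cast
    ring

theorem harm_sub_of_lt {a k : ℕ} (h : a < k) :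
    harm (k - a) = harm (k - a - 1) + 1 / ((k : ℝ) - a) := by
  obtain ⟨d, rfl⟩ := Nat.exists_eq_add_of_lt h
  have e1 : a + d + 1 - a = d + 1 := by omega
  rw [e1, harm_succ]
  simp only [Nat.add_sub_cancel]
  push_cast
  ring_nf

/-- The diagonal term vanishes since `1 / 0 = 0`. -/
theorem sum_inv_sub_eq {a k : ℕ} (ha : 1 ≤ a) (hak : a ≤ k) :
    ∑ b ∈ Finset.Icc 1 k, 1 / ((b : ℝ) - a) = harm (k - a) - harm (a - 1) := by
  induction k, hak using Nat.le_induction with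
  | base =>
    obtain ⟨d, rfl⟩ := Nat.exists_eq_add_of_le' ha
    rw [Finset.sum_Icc_succ_top (by omega)]
    rw [sub_self, div_zero, add_zero, Nat.add_sub_cancel, Nat.sub_self, harm_zero, zero_sub, harm,
      ← Finset.sum_neg_distrib]
    refine Finset.sum_bij' (fun b _ => d + 1 - b) (fun b _ => d + 1 - b) ?_ ?_ ?_ ?_ ?_
    · intro b hb; simp only [Finset.mem_Icc] at hb ⊢; omega
    · intro b hb; simp only [Finset.mem_Icc] at hb ⊢; omega
    · intro b hb; simp only [Finset.mem_Icc] at hb ⊢; omega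
    · intro b hb; simp only [Finset.mem_Icc] at hb ⊢; omega
    · intro b hb
      simp only [Finset.mem_Icc] at hb
      rw [Nat.cast_sub (by omega), ← neg_sub, one_div, one_div, inv_neg]
  | succ k hak ih =>
    rw [Finset.sum_Icc_succ_top (by omega), ih, harm_sub_of_lt (show a < k + 1 by omega)]
    rw [show k + 1 - a - 1 = k - a by omega]
    ring

theorem sum_inv_sq_sub_sq {a k : ℕ} (ha : 1 ≤ a) (hak : a ≤ k) :
    ∑ b ∈ Finset.Icc 1 k, 1 / ((b : ℝ) ^ 2 - (a : ℝ) ^ 2)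
      = 1 / (2 * a) * (3 / (2 * a) - (harm (k + a) - harm (k - a))) := by
  have ha0 : (a : ℝ) ≠ 0 := by positivity
  have key : ∀ b ∈ Finset.Icc 1 k, 1 / ((b : ℝ) ^ 2 - (a : ℝ) ^ 2)
      = 1 / (2 * a) * (1 / ((b : ℝ) - a) - 1 / ((a : ℝ) + b))
        -- At `b = a` the left side is `1/0 = 0`, but the partial fractions give `-1/(4a²)`. This
        -- correction, with `H_a - H_{a-1} = 1/a`, produces the `3/(2a)`.
        + if b = a then 1 / (4 * (a : ℝ) ^ 2) else 0 := by
    intro b hb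
    split_ifs with h
    · subst h
      simp only [sub_self, div_zero]
      field_simp
      ring
    · have h1 : (b : ℝ) - a ≠ 0 := sub_ne_zero.2 (by exact_mod_cast h)
      have h2 : (a : ℝ) + b ≠ 0 := by positivity
      have h3 : (b : ℝ) ^ 2 - (a : ℝ) ^ 2 ≠ 0 := by
        rw [show (b : ℝ) ^ 2 - (a : ℝ) ^ 2 = (b - a) * (a + b) by ring]
        exact mul_ne_zero h1 h2
      field_simp
      ring
  rw [Finset.sum_congr rfl key, Finset.sum_add_distrib, ← Finset.mul_sum,
    Finset.sum_sub_distrib, sum_inv_sub_eq ha hak, sum_inv_add_eq_harm_sub,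
    Finset.sum_ite_eq' , if_pos (Finset.mem_Icc.2 ⟨ha, hak⟩)]
  have h4 : harm a = harm (a - 1) + 1 / a := by
    obtain ⟨d, rfl⟩ := Nat.exists_eq_add_of_le' ha
    rw [harm_succ]; simp
  rw [h4, add_comm a k]
  field_simp
  ring

theorem sum_inv_mul_inv (a b k : ℕ) (ha : 1 ≤ a) (hb : 1 ≤ b) :
    ∑ c ∈ Finset.Icc 1 k,
        1 / (((a : ℝ) + (b : ℝ)) * ((b : ℝ) + (c : ℝ)) * ((c : ℝ) + (a : ℝ)))
      = ((harm (a + k) - harm a) - (harm (b + k) - harm b)) / ((b : ℝ) ^ 2 - (a : ℝ) ^ 2)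
        + if a = b then 1 / 2 * ∑ c ∈ Finset.Icc 1 k, 1 / ((a : ℝ) * ((a : ℝ) + c) ^ 2) else 0 := by
  split_ifs with h
  · subst h
    rw [sub_self, sub_self, div_zero, zero_add, Finset.mul_sum]
    refine Finset.sum_congr rfl fun c _ => ?_
    have : (0 : ℝ) < a := by positivity
    have : (0 : ℝ) < (a : ℝ) + c := by positivity
    rw [add_comm (c : ℝ) a]
    field_simp
    ring
  · rw [add_zero, ← sum_inv_add_eq_harm_sub, ← sum_inv_add_eq_harm_sub,
      ← Finset.sum_sub_distrib, Finset.sum_div]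
    refine Finset.sum_congr rfl fun c _ => ?_
    have h1 : (b : ℝ) - a ≠ 0 := sub_ne_zero.2 (by exact_mod_cast (Ne.symm h))
    have h2 : (a : ℝ) + b ≠ 0 := by positivity
    have h3 : (b : ℝ) ^ 2 - (a : ℝ) ^ 2 ≠ 0 := by
      rw [show (b : ℝ) ^ 2 - (a : ℝ) ^ 2 = (b - a) * (a + b) by ring]
      exact mul_ne_zero h1 h2
    have h4 : (b : ℝ) + c ≠ 0 := by positivity
    have h5 : (c : ℝ) + a ≠ 0 := by positivity
    have h6 : (a : ℝ) + c ≠ 0 := by positivity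
    field_simp
    ring

/-- The double sum in which the boundary term of the cubic sum is expressed. -/
noncomputable def tornheimSum (k : ℕ) : ℝ :=
  ∑ a ∈ Finset.Icc 1 k, ∑ c ∈ Finset.Icc 1 k, 1 / ((a : ℝ) * ((a : ℝ) + c) ^ 2)

/-- A discretisation of `∫₀¹ log ((1 + x) / x) log ((1 + x) / (1 - x)) / x`. -/
noncomputable def harmSum (k : ℕ) : ℝ :=
  ∑ a ∈ Finset.Icc 1 k, 1 / (a : ℝ) * (harm (a + k) - harm a) * (harm (k + a) - harm (k - a))

theorem sum_cube_eq (k : ℕ) :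
    ∑ m₁ ∈ Finset.Icc 1 k, ∑ m₂ ∈ Finset.Icc 1 k, ∑ m₃ ∈ Finset.Icc 1 k,
        1 / (((m₁ : ℝ) + (m₂ : ℝ)) * ((m₂ : ℝ) + (m₃ : ℝ)) * ((m₃ : ℝ) + (m₁ : ℝ)))
      = 3 / 2 * ∑ a ∈ Finset.Icc 1 k, (harm (a + k) - harm a) / (a : ℝ) ^ 2
        - harmSum k + 1 / 2 * tornheimSum k := by
  have e1 : ∀ a ∈ Finset.Icc 1 k, ∀ b ∈ Finset.Icc 1 k, _ := fun a ha b hb =>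
    sum_inv_mul_inv a b k (Finset.mem_Icc.1 ha).1 (Finset.mem_Icc.1 hb).1
  rw [Finset.sum_congr rfl fun a ha => Finset.sum_congr rfl (e1 a ha)]
  simp only [Finset.sum_add_distrib, sub_div _ (harm _ - harm _)]
  have hdiag : ∑ a ∈ Finset.Icc 1 k, ∑ b ∈ Finset.Icc 1 k, (if a = b then
      1 / 2 * ∑ c ∈ Finset.Icc 1 k, 1 / ((a : ℝ) * ((a : ℝ) + c) ^ 2) else 0)
      = 1 / 2 * tornheimSum k := by
    rw [tornheimSum, Finset.mul_sum]
    refine Finset.sum_congr rfl fun a ha => ?_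
    rw [Finset.sum_ite_eq, if_pos ha]
  rw [hdiag]
  congr 1
  simp only [Finset.sum_sub_distrib]
  -- The kernel `1/(b² - a²)` is antisymmetric, so both halves of the double sum agree; its diagonal
  -- contributes `0` by the convention for division.
  have hswap : ∑ a ∈ Finset.Icc 1 k, ∑ b ∈ Finset.Icc 1 k,
        (harm (b + k) - harm b) / ((b : ℝ) ^ 2 - (a : ℝ) ^ 2)
      = - ∑ a ∈ Finset.Icc 1 k, ∑ b ∈ Finset.Icc 1 k,
        (harm (a + k) - harm a) / ((b : ℝ) ^ 2 - (a : ℝ) ^ 2) := by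
    rw [Finset.sum_comm, ← Finset.sum_neg_distrib]
    refine Finset.sum_congr rfl fun a _ => ?_
    rw [← Finset.sum_neg_distrib]
    refine Finset.sum_congr rfl fun b _ => ?_
    rw [← neg_sub ((a : ℝ) ^ 2), div_neg, neg_neg]
  rw [hswap, sub_neg_eq_add, ← two_mul, harmSum, Finset.mul_sum, Finset.mul_sum,
    ← Finset.sum_sub_distrib]
  refine Finset.sum_congr rfl fun a ha => ?_
  have ha' := Finset.mem_Icc.1 ha
  have h0 : (a : ℝ) ≠ 0 := by have := ha'.1; positivity
  have : ∀ b ∈ Finset.Icc 1 k, (harm (a + k) - harm a) / ((b : ℝ) ^ 2 - (a : ℝ) ^ 2)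
      = (harm (a + k) - harm a) * (1 / ((b : ℝ) ^ 2 - (a : ℝ) ^ 2)) := fun b _ => by ring
  rw [Finset.sum_congr rfl this, ← Finset.mul_sum, sum_inv_sq_sub_sq ha'.1 ha'.2]
  field_simp

/-! ### Partial sums and tails of the zeta series. -/

theorem hasSum_one_div_pow_riemannZeta {j : ℕ} (hj : 2 ≤ j) :
    HasSum (fun n : ℕ => 1 / (n : ℝ) ^ j) (riemannZeta j).re := by
  have h1 : Summable (fun n : ℕ => 1 / (n : ℝ) ^ j) := Real.summable_one_div_nat_pow.2 (by omega)
  have h2 : (riemannZeta j).re = ∑' n : ℕ, 1 / (n : ℝ) ^ j := by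
    rw [zeta_nat_eq_tsum_of_gt_one (by omega), ← Complex.ofReal_re (∑' n : ℕ, 1 / (n : ℝ) ^ j),
      Complex.ofReal_tsum]
    push_cast
    rfl
  rw [h2]
  exact h1.hasSum

theorem sum_Ioc_one_div_pow_le {j k n : ℕ} (hj : 2 ≤ j) (hk : 1 ≤ k) :
    ∑ m ∈ Finset.Ioc k n, 1 / (m : ℝ) ^ j ≤ 1 / (k : ℝ) := by
  rcases le_total n k with h | h
  · rw [Finset.Ioc_eq_empty (by omega)]
    simp
  calc ∑ m ∈ Finset.Ioc k n, 1 / (m : ℝ) ^ j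
      ≤ ∑ m ∈ Finset.Ioc k n, ((m : ℝ) ^ 2)⁻¹ := by
        refine Finset.sum_le_sum fun m hm => ?_
        have hm1 : (1 : ℝ) ≤ m := by
          have := (Finset.mem_Ioc.1 hm).1
          exact_mod_cast (by omega : 1 ≤ m)
        rw [one_div]
        exact inv_anti₀ (by positivity) (pow_le_pow_right₀ hm1 hj)
    _ ≤ (k : ℝ)⁻¹ - (n : ℝ)⁻¹ := sum_Ioc_inv_sq_le_sub (by omega) h
    _ ≤ 1 / (k : ℝ) := by
        rw [one_div]
        have : (0 : ℝ) ≤ (n : ℝ)⁻¹ := by positivity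
        linarith

theorem sum_Icc_add_sum_Ioc (f : ℕ → ℝ) {k n : ℕ} (h : k ≤ n) :
    ∑ m ∈ Finset.Icc 1 k, f m + ∑ m ∈ Finset.Ioc k n, f m = ∑ m ∈ Finset.Icc 1 n, f m := by
  have e : ∀ n : ℕ, Finset.Icc 1 n = Finset.Ioc 0 n := fun n => rfl
  rw [e, e]
  exact Finset.sum_Ioc_consecutive f (Nat.zero_le k) h

theorem sum_one_div_pow_le_riemannZeta {j : ℕ} (hj : 2 ≤ j) (k : ℕ) :
    ∑ m ∈ Finset.Icc 1 k, 1 / (m : ℝ) ^ j ≤ (riemannZeta j).re :=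
  sum_le_hasSum _ (fun _ _ => by positivity) (hasSum_one_div_pow_riemannZeta hj)

theorem riemannZeta_le_sum_one_div_pow {j k : ℕ} (hj : 2 ≤ j) (hk : 1 ≤ k) :
    (riemannZeta j).re ≤ ∑ m ∈ Finset.Icc 1 k, 1 / (m : ℝ) ^ j + 1 / k := by
  have h := (hasSum_one_div_pow_riemannZeta hj).tendsto_sum_nat
  refine le_of_tendsto h (eventually_atTop.2 ⟨k + 1, fun n hn => ?_⟩)
  obtain ⟨d, rfl⟩ := Nat.exists_eq_add_of_le' (show 1 ≤ n by omega)
  have e : ∑ m ∈ Finset.range (d + 1), 1 / (m : ℝ) ^ j = ∑ m ∈ Finset.Icc 1 d, 1 / (m : ℝ) ^ j := by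
    rw [Finset.range_eq_Ico, Finset.sum_eq_sum_Ico_succ_bot (by omega)]
    simp only [Nat.cast_zero, zero_pow (show j ≠ 0 by omega), div_zero, zero_add]
    rfl
  rw [e, ← sum_Icc_add_sum_Ioc _ (show k ≤ d by omega)]
  linarith [sum_Ioc_one_div_pow_le (n := d) hj hk]

/-! ### The Euler and Tornheim sums. -/

/-- Partial sums of `∑ H_a / a²`. -/
noncomputable def eulerSum (k : ℕ) : ℝ := ∑ a ∈ Finset.Icc 1 k, harm a / (a : ℝ) ^ 2

/-- The difference between `∑_{a ≤ k} H_{a + k} / a²` and `H_k ∑_{a ≤ k} 1 / a²`. -/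
noncomputable def shiftError (k : ℕ) : ℝ :=
  ∑ a ∈ Finset.Icc 1 k, (harm (a + k) - harm k) / (a : ℝ) ^ 2

theorem shiftError_nonneg (k : ℕ) : 0 ≤ shiftError k :=
  Finset.sum_nonneg fun a _ =>
    div_nonneg (sub_nonneg.2 (harm_mono (Nat.le_add_left k a))) (by positivity)

theorem shiftError_le {k : ℕ} (hk : 1 ≤ k) : shiftError k ≤ harm k / k := by
  have e : harm k / k = ∑ a ∈ Finset.Icc 1 k, 1 / (a : ℝ) / k := Finset.sum_div ..
  rw [shiftError, e]
  refine Finset.sum_le_sum fun a ha => ?_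
  have ha' : (0 : ℝ) < a := by have := (Finset.mem_Icc.1 ha).1; positivity
  have hk' : (0 : ℝ) < k := by positivity
  have h : harm (a + k) - harm k ≤ a / k := by
    rw [add_comm, ← sum_inv_add_eq_harm_sub]
    calc ∑ c ∈ Finset.Icc 1 a, 1 / ((k : ℝ) + c) ≤ ∑ c ∈ Finset.Icc 1 a, 1 / (k : ℝ) :=
          Finset.sum_le_sum fun c _ => one_div_le_one_div_of_le hk' (by simp)
      _ = a / k := by simp [div_eq_mul_inv]
  calc (harm (a + k) - harm k) / (a : ℝ) ^ 2 ≤ (a / k) / (a : ℝ) ^ 2 := by gcongr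
    _ = 1 / (a : ℝ) / k := by field_simp

/-- Symmetrise in `a` and `c`: `1/(a(a+c)²) + 1/(c(a+c)²) = 1/(ac(a+c)) = (1/c - 1/(a+c))/a²`, whose
sum over `c` consists of harmonic numbers. -/
theorem tornheimSum_eq (k : ℕ) : tornheimSum k = 1 / 2 * (eulerSum k - shiftError k) := by
  have h : 2 * tornheimSum k = eulerSum k - shiftError k := by
    have hsw : tornheimSum k
        = ∑ a ∈ Finset.Icc 1 k, ∑ c ∈ Finset.Icc 1 k, 1 / ((c : ℝ) * ((a : ℝ) + c) ^ 2) := by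
      rw [tornheimSum, Finset.sum_comm]
      simp only [add_comm]
    rw [two_mul]
    nth_rewrite 2 [hsw]
    rw [tornheimSum, ← Finset.sum_add_distrib, eulerSum, shiftError, ← Finset.sum_sub_distrib]
    refine Finset.sum_congr rfl fun a ha => ?_
    have ha' : (0 : ℝ) < a := by have := (Finset.mem_Icc.1 ha).1; positivity
    rw [← Finset.sum_add_distrib, ← sub_div]
    have e : ∀ c ∈ Finset.Icc 1 k, 1 / ((a : ℝ) * ((a : ℝ) + c) ^ 2)
        + 1 / ((c : ℝ) * ((a : ℝ) + c) ^ 2) = (1 / (c : ℝ) - 1 / ((a : ℝ) + c)) / (a : ℝ) ^ 2 := by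
      intro c hc
      have hc' : (0 : ℝ) < c := by have := (Finset.mem_Icc.1 hc).1; positivity
      field_simp
      ring
    rw [Finset.sum_congr rfl e, ← Finset.sum_div, Finset.sum_sub_distrib, sum_inv_add_eq_harm_sub,
      ← harm]
    congr 1
    ring
  linarith

theorem tornheimSum_eq_sum_Ioc (k : ℕ) :
    tornheimSum k = ∑ a ∈ Finset.Icc 1 k, 1 / (a : ℝ) * ∑ m ∈ Finset.Ioc a (a + k), 1 / (m : ℝ) ^ 2 := by
  refine Finset.sum_congr rfl fun a _ => ?_
  rw [Finset.mul_sum]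
  refine Finset.sum_bij' (fun c _ => a + c) (fun m _ => m - a) ?_ ?_ ?_ ?_ ?_
  · intro b hb; simp only [Finset.mem_Icc, Finset.mem_Ioc] at hb ⊢; omega
  · intro b hb; simp only [Finset.mem_Icc, Finset.mem_Ioc] at hb ⊢; omega
  · intro b hb; simp only [Finset.mem_Icc] at hb ⊢; omega
  · intro b hb; simp only [Finset.mem_Ioc] at hb ⊢; omega
  · intro c hc
    rw [Nat.cast_add, one_div_mul_one_div]

/-- Expand `H_m = ∑_{a ≤ m} 1/a`, separate `a = m`, and interchange the order of summation. The
remainder matches `tornheimSum_eq_sum_Ioc` except that `m` stops at `k` instead of `a + k`. -/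
theorem eulerSum_eq (k : ℕ) :
    eulerSum k = ∑ a ∈ Finset.Icc 1 k, 1 / (a : ℝ) ^ 3
      + ∑ a ∈ Finset.Icc 1 k, 1 / (a : ℝ) * ∑ m ∈ Finset.Ioc a k, 1 / (m : ℝ) ^ 2 := by
  induction k with
  | zero => simp [eulerSum]
  | succ k ih =>
    have e : ∑ a ∈ Finset.Icc 1 k, 1 / (a : ℝ) * ∑ m ∈ Finset.Ioc a (k + 1), 1 / (m : ℝ) ^ 2
        = ∑ a ∈ Finset.Icc 1 k, 1 / (a : ℝ) * ∑ m ∈ Finset.Ioc a k, 1 / (m : ℝ) ^ 2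
          + harm k * (1 / ((k : ℝ) + 1) ^ 2) := by
      rw [harm, Finset.sum_mul, ← Finset.sum_add_distrib]
      refine Finset.sum_congr rfl fun a ha => ?_
      rw [Finset.sum_Ioc_succ_top (Finset.mem_Icc.1 ha).2]
      push_cast
      ring
    rw [eulerSum, Finset.sum_Icc_succ_top (by omega), ← eulerSum, ih,
      Finset.sum_Icc_succ_top (by omega), Finset.sum_Icc_succ_top (by omega), e, harm_succ]
    simp only [Finset.Ioc_self, Finset.sum_empty]
    push_cast
    field_simp
    ring

theorem sum_tail_bounds {k : ℕ} (hk : 1 ≤ k) :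
    0 ≤ tornheimSum k - (eulerSum k - ∑ a ∈ Finset.Icc 1 k, 1 / (a : ℝ) ^ 3) ∧
      tornheimSum k - (eulerSum k - ∑ a ∈ Finset.Icc 1 k, 1 / (a : ℝ) ^ 3) ≤ harm k / k := by
  have e : tornheimSum k - (eulerSum k - ∑ a ∈ Finset.Icc 1 k, 1 / (a : ℝ) ^ 3)
      = ∑ a ∈ Finset.Icc 1 k, 1 / (a : ℝ) * ∑ m ∈ Finset.Ioc k (a + k), 1 / (m : ℝ) ^ 2 := by
    rw [eulerSum_eq, tornheimSum_eq_sum_Ioc, add_sub_cancel_left, ← Finset.sum_sub_distrib]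
    refine Finset.sum_congr rfl fun a ha => ?_
    rw [← Finset.sum_Ioc_consecutive _ (Finset.mem_Icc.1 ha).2 (Nat.le_add_left k a)]
    ring
  rw [e]
  refine ⟨by positivity, ?_⟩
  rw [harm, Finset.sum_div]
  refine Finset.sum_le_sum fun a _ => ?_
  rw [div_eq_mul_one_div (1 / (a : ℝ))]
  gcongr
  exact sum_Ioc_one_div_pow_le le_rfl hk

/-- Write `X` for `shiftError k` and `Y` for the tail in `sum_tail_bounds`. Solving the two
relations gives `eulerSum = 2 Z3 - X - 2Y` and `tornheimSum = Z3 - X - Y`, so the cube sum is `3/2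
H_k Z2 - 5/2 Z3 + 5/2 (X + Y) - harmSum`. The bound adds `3/2 + 5/2 + 5/2 = 13/2`. -/
theorem abs_sum_cube_sub_le {k : ℕ} (hk : 1 ≤ k) :
    |(∑ m₁ ∈ Finset.Icc 1 k, ∑ m₂ ∈ Finset.Icc 1 k, ∑ m₃ ∈ Finset.Icc 1 k,
          1 / (((m₁ : ℝ) + (m₂ : ℝ)) * ((m₂ : ℝ) + (m₃ : ℝ)) * ((m₃ : ℝ) + (m₁ : ℝ))))
        - ((3 / 2 : ℝ) * (riemannZeta 2).re * harm k - (41 / 8 : ℝ) * (riemannZeta 3).re)|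
      ≤ 13 / 2 * harm k / k + 5 / 2 * (1 / k)
        + |harmSum k - 21 / 8 * (riemannZeta 3).re| := by
  have hk' : (0 : ℝ) < k := by positivity
  have hz2 := sum_one_div_pow_le_riemannZeta (le_refl 2) k
  have hz2' := riemannZeta_le_sum_one_div_pow (le_refl 2) hk
  have hz3 := sum_one_div_pow_le_riemannZeta (show 2 ≤ 3 by norm_num) k
  have hz3' := riemannZeta_le_sum_one_div_pow (show 2 ≤ 3 by norm_num) hk
  push_cast at hz2 hz2' hz3 hz3'
  obtain ⟨hY, hY'⟩ := sum_tail_bounds hk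
  have hX := shiftError_nonneg k
  have hX' := shiftError_le hk
  have hT := tornheimSum_eq k
  have hA : ∑ a ∈ Finset.Icc 1 k, (harm (a + k) - harm a) / (a : ℝ) ^ 2
      = harm k * ∑ a ∈ Finset.Icc 1 k, 1 / (a : ℝ) ^ 2 + shiftError k - eulerSum k := by
    rw [Finset.mul_sum, shiftError, eulerSum, ← Finset.sum_add_distrib, ← Finset.sum_sub_distrib]
    refine Finset.sum_congr rfl fun a _ => ?_
    ring
  rw [sum_cube_eq, hA]
  set Z2 := ∑ a ∈ Finset.Icc 1 k, 1 / (a : ℝ) ^ 2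
  set Z3 := ∑ a ∈ Finset.Icc 1 k, 1 / (a : ℝ) ^ 3
  have hH := harm_nonneg k
  have hm1 : 0 ≤ harm k * ((riemannZeta 2).re - Z2) := mul_nonneg hH (by linarith)
  have hm2 : harm k * ((riemannZeta 2).re - Z2) ≤ harm k / k := by
    rw [div_eq_mul_one_div]
    exact mul_le_mul_of_nonneg_left (by linarith) hH
  have e13 : 13 / 2 * harm k / k = 13 / 2 * (harm k / k) := by ring
  rw [e13, abs_le]
  constructor
  · linarith [le_abs_self (harmSum k - 21 / 8 * (riemannZeta 3).re)]
  · linarith [neg_abs_le (harmSum k - 21 / 8 * (riemannZeta 3).re)]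

/-! ### A calculus of integrals over the unit interval. -/

/-- `f` is integrable on `(0, 1)` with integral `A`. -/
def HasUnitIntegral (f : ℝ → ℝ) (A : ℝ) : Prop :=
  MeasureTheory.IntegrableOn f (Set.Ioo 0 1) ∧ ∫ x in Set.Ioo (0 : ℝ) 1, f x = A

namespace HasUnitIntegral

theorem congr {f g : ℝ → ℝ} {A B : ℝ} (hf : HasUnitIntegral f A)
    (h : ∀ x, 0 < x → x < 1 → f x = g x) (hAB : A = B) : HasUnitIntegral g B := by
  have h' : Set.EqOn f g (Set.Ioo 0 1) := fun x hx => h x hx.1 hx.2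
  exact ⟨hf.1.congr_fun h' measurableSet_Ioo, by
    rw [← hAB, ← hf.2, MeasureTheory.setIntegral_congr_fun measurableSet_Ioo h']⟩

theorem add {f g : ℝ → ℝ} {A B : ℝ} (hf : HasUnitIntegral f A) (hg : HasUnitIntegral g B) :
    HasUnitIntegral (fun x => f x + g x) (A + B) :=
  ⟨hf.1.add hg.1, by rw [MeasureTheory.integral_add hf.1 hg.1, hf.2, hg.2]⟩

theorem const_mul {f : ℝ → ℝ} {A : ℝ} (c : ℝ) (hf : HasUnitIntegral f A) :
    HasUnitIntegral (fun x => c * f x) (c * A) :=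
  ⟨hf.1.const_mul c, by rw [MeasureTheory.integral_const_mul, hf.2]⟩

theorem subst {g : ℝ → ℝ} {A : ℝ} (hg : HasUnitIntegral g A) {u u' v : ℝ → ℝ}
    (hu : ∀ x, 0 < x → x < 1 → HasDerivAt u (u' x) x)
    (hmap : ∀ x, 0 < x → x < 1 → 0 < u x ∧ u x < 1 ∧ v (u x) = x)
    (hinv : ∀ y, 0 < y → y < 1 → 0 < v y ∧ v y < 1 ∧ u (v y) = y) :
    HasUnitIntegral (fun x => |u' x| * g (u x)) A := by
  have himg : u '' Set.Ioo 0 1 = Set.Ioo 0 1 := by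
    ext y
    constructor
    · rintro ⟨x, hx, rfl⟩
      exact ⟨(hmap x hx.1 hx.2).1, (hmap x hx.1 hx.2).2.1⟩
    · intro hy
      obtain ⟨h1, h2, h3⟩ := hinv y hy.1 hy.2
      exact ⟨v y, ⟨h1, h2⟩, h3⟩
  have hinj : Set.InjOn u (Set.Ioo 0 1) := fun x hx y hy hxy => by
    rw [← (hmap x hx.1 hx.2).2.2, ← (hmap y hy.1 hy.2).2.2, hxy]
  have hder : ∀ x ∈ Set.Ioo (0 : ℝ) 1, HasDerivWithinAt u (u' x) (Set.Ioo 0 1) x :=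
    fun x hx => (hu x hx.1 hx.2).hasDerivWithinAt
  have h1 := MeasureTheory.integrableOn_image_iff_integrableOn_abs_deriv_smul
    measurableSet_Ioo hder hinj g
  have h2 := MeasureTheory.integral_image_eq_integral_abs_deriv_smul
    measurableSet_Ioo hder hinj g
  rw [himg] at h1 h2
  exact ⟨h1.1 hg.1, h2.symm.trans hg.2⟩

/-- Termwise integration of nonnegative functions. Integrability of the limit comes from `A ≠ 0`,
since a non-integrable function has Bochner integral `0`. -/
theorem of_hasSum {F : ℕ → ℝ → ℝ} {f : ℝ → ℝ} {a : ℕ → ℝ} {A : ℝ}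
    (hF : ∀ n, HasUnitIntegral (F n) (a n)) (hnn : ∀ n x, 0 < x → x < 1 → 0 ≤ F n x)
    (ha : HasSum a A) (hA : A ≠ 0) (hf : ∀ x, 0 < x → x < 1 → HasSum (fun n => F n x) (f x)) :
    HasUnitIntegral f A := by
  have hnorm : ∀ n, ∫ x in Set.Ioo (0 : ℝ) 1, ‖F n x‖ = a n := fun n => by
    rw [← (hF n).2]
    exact MeasureTheory.setIntegral_congr_fun measurableSet_Ioo fun x hx =>
      Real.norm_of_nonneg (hnn n x hx.1 hx.2)
  have h := MeasureTheory.hasSum_integral_of_summable_integral_norm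
    (μ := MeasureTheory.volume.restrict (Set.Ioo (0 : ℝ) 1)) (F := F) (fun n => (hF n).1)
    (by simpa only [hnorm] using ha.summable)
  have e : ∫ x in Set.Ioo (0 : ℝ) 1, ∑' n, F n x = ∫ x in Set.Ioo (0 : ℝ) 1, f x :=
    MeasureTheory.setIntegral_congr_fun measurableSet_Ioo fun x hx => (hf x hx.1 hx.2).tsum_eq
  simp only [(hF _).2] at h
  rw [e] at h
  have hval := h.unique ha
  exact ⟨MeasureTheory.Integrable.of_integral_ne_zero (hval ▸ hA), hval⟩

theorem of_deriv {G g : ℝ → ℝ} {A : ℝ} (hcont : ContinuousOn G (Set.Icc 0 1))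
    (hderiv : ∀ x, 0 < x → x < 1 → HasDerivAt G (g x) x) (hnn : ∀ x, 0 < x → x < 1 → 0 ≤ g x)
    (hA : G 1 - G 0 = A) : HasUnitIntegral g A := by
  have hi := intervalIntegral.integrableOn_deriv_of_nonneg hcont
    (fun x hx => hderiv x hx.1 hx.2) (fun x hx => hnn x hx.1 hx.2)
  refine ⟨hi.mono_set Set.Ioo_subset_Ioc_self, ?_⟩
  rw [← MeasureTheory.integral_Ioc_eq_integral_Ioo, ← intervalIntegral.integral_of_le zero_le_one,
    intervalIntegral.integral_eq_sub_of_hasDerivAt_of_le zero_le_one hcont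
      (fun x hx => hderiv x hx.1 hx.2)
      ((intervalIntegrable_iff_integrableOn_Ioc_of_le zero_le_one).2 hi), hA]

end HasUnitIntegral

/-! ### Logarithmic integrals evaluating to multiples of `ζ(3)`. -/

theorem hasUnitIntegral_pow_mul_neg_log (m : ℕ) :
    HasUnitIntegral (fun t => t ^ m * -Real.log t) (1 / ((m : ℝ) + 1) ^ 2) := by
  have hm : (m : ℝ) + 1 ≠ 0 := by positivity
  refine HasUnitIntegral.of_deriv
    -- Grouping `t * log t` makes the antiderivative visibly continuous at `0`.
    (G := fun t => t ^ (m + 1) / ((m : ℝ) + 1) ^ 2 - t ^ m * (t * Real.log t) / ((m : ℝ) + 1))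
    ?_ ?_ ?_ ?_
  · have := Real.continuous_mul_log
    exact Continuous.continuousOn (by fun_prop)
  · intro t h0 _
    have h1 := ((hasDerivAt_pow (m + 1) t).div_const (((m : ℝ) + 1) ^ 2)).sub
      (((hasDerivAt_pow (m + 1) t).mul (Real.hasDerivAt_log h0.ne')).div_const ((m : ℝ) + 1))
    have e : (fun t : ℝ => t ^ (m + 1) / ((m : ℝ) + 1) ^ 2
        - t ^ m * (t * Real.log t) / ((m : ℝ) + 1))
        = (fun t : ℝ => t ^ (m + 1) / ((m : ℝ) + 1) ^ 2)
          - fun t : ℝ => t ^ (m + 1) * Real.log t / ((m : ℝ) + 1) := by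
      funext t; simp only [Pi.sub_apply]; ring
    rw [e]
    refine h1.congr_deriv ?_
    simp only [Nat.add_sub_cancel]
    push_cast
    field_simp
    ring
  · intro t h0 h1
    exact mul_nonneg (by positivity) (neg_nonneg.2 (Real.log_nonpos h0.le h1.le))
  · simp

theorem continuousOn_mul_log_sq :
    ContinuousOn (fun t : ℝ => t * Real.log t ^ 2) (Set.Icc 0 1) := by
  have h : Continuous fun t : ℝ => 4 * (√t * Real.log √t) ^ 2 :=
    continuous_const.mul ((Real.continuous_mul_log.comp Real.continuous_sqrt).pow 2)
  refine h.continuousOn.congr fun t ht => ?_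
  simp only [Real.log_sqrt ht.1, mul_pow, Real.sq_sqrt ht.1]
  ring

theorem hasUnitIntegral_pow_mul_log_sq (m : ℕ) :
    HasUnitIntegral (fun t => t ^ m * Real.log t ^ 2) (2 / ((m : ℝ) + 1) ^ 3) := by
  have hm : (m : ℝ) + 1 ≠ 0 := by positivity
  refine HasUnitIntegral.of_deriv
    (G := fun t => t ^ m * (t * Real.log t ^ 2) / ((m : ℝ) + 1)
      - 2 * (t ^ m * (t * Real.log t)) / ((m : ℝ) + 1) ^ 2 + 2 * t ^ (m + 1) / ((m : ℝ) + 1) ^ 3)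
    ?_ ?_ ?_ ?_
  · have h1 := Real.continuous_mul_log.continuousOn (s := Set.Icc (0 : ℝ) 1)
    have h2 := continuousOn_mul_log_sq
    fun_prop
  · intro t h0 _
    have hp := hasDerivAt_pow (m + 1) t
    have hl := Real.hasDerivAt_log h0.ne'
    have h1 := (((hp.mul (hl.pow 2)).div_const ((m : ℝ) + 1)).sub
      (((hp.mul hl).const_mul 2).div_const (((m : ℝ) + 1) ^ 2))).add
      ((hp.const_mul 2).div_const (((m : ℝ) + 1) ^ 3))
    refine (h1.congr_deriv (g' := t ^ m * Real.log t ^ 2) ?_).congr_of_eventuallyEq ?_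
    · simp only [Nat.add_sub_cancel, Pi.pow_apply]
      push_cast
      field_simp
      ring
    · refine Eventually.of_forall fun s => ?_
      simp only [Pi.add_apply, Pi.sub_apply, Pi.mul_apply, Pi.pow_apply]
      ring
  · intro t h0 _
    positivity
  · simp

/-- The real number `ζ(3)`. -/
noncomputable abbrev zetaThree : ℝ := (riemannZeta 3).re

theorem hasSum_zetaThree : HasSum (fun n : ℕ => 1 / ((n : ℝ) + 1) ^ 3) zetaThree := by
  have h := hasSum_one_div_pow_riemannZeta (show 2 ≤ 3 by norm_num)
  have h' := (hasSum_nat_add_iff' 1).2 h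
  simpa using h'

theorem zetaThree_pos : 0 < zetaThree :=
  (by norm_num : (0 : ℝ) < 1 / (((0 : ℕ) : ℝ) + 1) ^ 3).trans_le
    (le_hasSum hasSum_zetaThree 0 fun _ _ => by positivity)

theorem hasSum_odd_cube : HasSum (fun n : ℕ => 1 / (2 * (n : ℝ) + 1) ^ 3) (7 / 8 * zetaThree) := by
  have h : HasSum (fun n : ℕ => 1 / (n : ℝ) ^ 3) zetaThree :=
    hasSum_one_div_pow_riemannZeta (show 2 ≤ 3 by norm_num)
  generalize zetaThree = z at h ⊢
  have heven : HasSum (fun n : ℕ => 1 / ((2 * n : ℕ) : ℝ) ^ 3) (1 / 8 * z) := by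
    have e : (fun n : ℕ => 1 / ((2 * n : ℕ) : ℝ) ^ 3) = fun n : ℕ => 1 / 8 * (1 / (n : ℝ) ^ 3) := by
      funext n
      push_cast
      rw [mul_pow, one_div_mul_one_div]
      norm_num
    rw [e]
    exact h.mul_left (1 / 8)
  have hodd : Summable (fun n : ℕ => 1 / ((2 * n + 1 : ℕ) : ℝ) ^ 3) :=
    h.summable.comp_injective (i := fun n : ℕ => 2 * n + 1) fun a b hab => by
      simp only at hab
      omega
  have e := (HasSum.even_add_odd (f := fun n : ℕ => 1 / (n : ℝ) ^ 3) heven hodd.hasSum).unique h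
  have e' : 7 / 8 * z = ∑' n : ℕ, 1 / ((2 * n + 1 : ℕ) : ℝ) ^ 3 := by linarith
  rw [e']
  have := hodd.hasSum
  push_cast at this ⊢
  exact this

theorem hasUnitIntegral_log_sq_div_one_sub :
    HasUnitIntegral (fun t => Real.log t ^ 2 / (1 - t)) (2 * zetaThree) := by
  refine HasUnitIntegral.of_hasSum hasUnitIntegral_pow_mul_log_sq
    (fun n x h0 _ => by positivity) ?_ (by have := zetaThree_pos; positivity) ?_
  · simpa only [mul_one_div] using hasSum_zetaThree.mul_left 2
  · intro x h0 h1
    simpa only [mul_comm, div_eq_mul_inv] using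
      (hasSum_geometric_of_lt_one h0.le h1).mul_left (Real.log x ^ 2)

theorem HasUnitIntegral.comp_sq {g : ℝ → ℝ} {A : ℝ} (hg : HasUnitIntegral g A) :
    HasUnitIntegral (fun x => 2 * x * g (x ^ 2)) A := by
  refine (hg.subst (u := fun x => x ^ 2) (u' := fun x => 2 * x) (v := Real.sqrt) ?_ ?_ ?_).congr
    (fun x h0 h1 => ?_) rfl
  · intro x _ _
    simpa using hasDerivAt_pow 2 x
  · intro x h0 h1
    exact ⟨by positivity, pow_lt_one₀ h0.le h1 two_ne_zero, Real.sqrt_sq h0.le⟩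
  · intro y h0 h1
    exact ⟨Real.sqrt_pos.2 h0, by rw [Real.sqrt_lt' one_pos]; simpa using h1, Real.sq_sqrt h0.le⟩
  · rw [abs_of_pos (by positivity)]

theorem hasUnitIntegral_log_sq_div_one_sub_sq :
    HasUnitIntegral (fun t => 2 * Real.log t ^ 2 / (1 - t ^ 2)) (7 / 2 * zetaThree) := by
  have h := hasUnitIntegral_log_sq_div_one_sub
  -- `2/(1-t²) = 2/(1-t) - 2t/(1-t²)`; the last term comes from the substitution `t ↦ t²`, and `4 -
  -- 1/2 = 7/2`.
  refine ((h.const_mul 2).add (h.comp_sq.const_mul (-1 / 4))).congr (fun t h0 h1 => ?_) (by ring)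
  have e1 : 1 - t ≠ 0 := by linarith
  have e2 : 1 + t ≠ 0 := by linarith
  rw [Real.log_pow, show 1 - t ^ 2 = (1 - t) * (1 + t) by ring]
  push_cast
  field_simp
  ring

/-- Twice the inverse hyperbolic tangent. -/
noncomputable def logRatio (x : ℝ) : ℝ := Real.log (1 + x) - Real.log (1 - x)

/-- The involution `t = (1-x)/(1+x)` turns `log t` into `-logRatio x` and `2 dt/(1-t²)` into `dx/x`
up to orientation. -/
theorem hasUnitIntegral_logRatio_sq_div :
    HasUnitIntegral (fun x => logRatio x ^ 2 / x) (7 / 2 * zetaThree) := by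
  have hmap : ∀ x : ℝ, 0 < x → x < 1 → 0 < (1 - x) / (1 + x) ∧ (1 - x) / (1 + x) < 1 ∧
      (1 - (1 - x) / (1 + x)) / (1 + (1 - x) / (1 + x)) = x := by
    intro x h0 h1
    have e1 : 0 < 1 - x := by linarith
    have e2 : 0 < 1 + x := by linarith
    refine ⟨by positivity, (div_lt_one e2).2 (by linarith), ?_⟩
    have e3 : 1 + (1 - x) / (1 + x) ≠ 0 := by positivity
    field_simp
    ring
  refine (hasUnitIntegral_log_sq_div_one_sub_sq.subst (u := fun x => (1 - x) / (1 + x))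
    (u' := fun x => -2 / (1 + x) ^ 2) (v := fun x => (1 - x) / (1 + x)) ?_ hmap hmap).congr
    (fun x h0 h1 => ?_) rfl
  · intro x h0 h1
    have e2 : 1 + x ≠ 0 := by linarith
    refine (((hasDerivAt_id x).const_sub 1).div ((hasDerivAt_id x).const_add 1) e2).congr_deriv ?_
    simp only [id]
    field_simp
    ring
  · have e1 : 0 < 1 - x := by linarith
    have e2 : 0 < 1 + x := by linarith
    rw [neg_div, abs_neg, abs_of_pos (by positivity), Real.log_div e1.ne' e2.ne', logRatio,
      show 1 - ((1 - x) / (1 + x)) ^ 2 = 4 * x / (1 + x) ^ 2 by field_simp; ring]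
    field_simp
    ring

theorem hasUnitIntegral_log_one_sub_sq_div :
    HasUnitIntegral (fun x => Real.log (1 - x) ^ 2 / x) (2 * zetaThree) := by
  have hmap : ∀ x : ℝ, 0 < x → x < 1 → 0 < 1 - x ∧ 1 - x < 1 ∧ 1 - (1 - x) = x :=
    fun x h0 h1 => ⟨by linarith, by linarith, by ring⟩
  refine (hasUnitIntegral_log_sq_div_one_sub.subst (u := fun x => 1 - x)
    (u' := fun _ => -1) (v := fun x => 1 - x) ?_ hmap hmap).congr (fun x h0 h1 => ?_) rfl
  · intro x _ _
    exact (hasDerivAt_id x).const_sub 1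
  · simp

theorem hasUnitIntegral_logRatio_mul_log_one_add_div :
    HasUnitIntegral (fun x => logRatio x * Real.log (1 + x) / x) (7 / 8 * zetaThree) := by
  have h := hasUnitIntegral_log_one_sub_sq_div
  -- With `p = log(1+x)` and `q = log(1-x)`: `(p-q)p = 3/4 (p-q)² + 1/4 (p+q)² - q²`, where `p + q =
  -- log(1-x²)`. The values add to `21/8 + 1/4 - 2 = 7/8`.
  refine (((hasUnitIntegral_logRatio_sq_div.const_mul (3 / 4)).add
    (h.comp_sq.const_mul (1 / 8))).add (h.const_mul (-1))).congr (fun x h0 h1 => ?_) (by ring)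
  have e1 : 1 - x ≠ 0 := by linarith
  have e2 : 1 + x ≠ 0 := by linarith
  rw [logRatio, show 1 - x ^ 2 = (1 - x) * (1 + x) by ring, Real.log_mul e1 e2]
  field_simp
  ring

theorem hasSum_logRatio_div {x : ℝ} (h0 : 0 < x) (h1 : x < 1) :
    HasSum (fun n : ℕ => 2 / (2 * (n : ℝ) + 1) * x ^ (2 * n)) (logRatio x / x) := by
  have h := (Real.hasSum_log_sub_log_of_abs_lt_one (abs_lt.2 ⟨by linarith, h1⟩)).div_const x
  refine h.congr_fun fun n => ?_
  rw [pow_succ]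
  field_simp

theorem hasUnitIntegral_logRatio_mul_neg_log_div :
    HasUnitIntegral (fun x => logRatio x / x * -Real.log x) (7 / 4 * zetaThree) := by
  refine HasUnitIntegral.of_hasSum
    (F := fun n x => 2 / (2 * (n : ℝ) + 1) * (x ^ (2 * n) * -Real.log x))
    (fun n => (hasUnitIntegral_pow_mul_neg_log (2 * n)).const_mul _) ?_
    (A := 7 / 4 * zetaThree) ?_ (by have := zetaThree_pos; positivity) ?_
  · intro n x h0 h1
    exact mul_nonneg (by positivity)
      (mul_nonneg (by positivity) (neg_nonneg.2 (Real.log_nonpos h0.le h1.le)))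
  · have h := hasSum_odd_cube.mul_left 2
    rw [show 2 * (7 / 8 * zetaThree) = 7 / 4 * zetaThree by ring] at h
    refine h.congr_fun fun n => ?_
    push_cast
    field_simp
  · intro x h0 h1
    simpa only [mul_assoc] using (hasSum_logRatio_div h0 h1).mul_right (-Real.log x)

/-- `log ((1 + x) / x)`. -/
noncomputable def logOneAddInv (x : ℝ) : ℝ := Real.log (1 + x) - Real.log x

theorem hasUnitIntegral_logRatio_mul_logOneAddInv :
    HasUnitIntegral (fun x => logRatio x / x * logOneAddInv x) (21 / 8 * zetaThree) := by
  refine (hasUnitIntegral_logRatio_mul_log_one_add_div.add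
    hasUnitIntegral_logRatio_mul_neg_log_div).congr (fun x _ _ => ?_) (by ring)
  rw [logOneAddInv]
  ring

/-! ### Comparing the terms of `harmSum` with the limiting integrand. -/

theorem one_div_succ_le_log_sub_log {j : ℝ} (hj : 0 < j) :
    1 / (j + 1) ≤ Real.log (j + 1) - Real.log j := by
  have h := Real.one_sub_inv_le_log_of_pos (show 0 < (j + 1) / j by positivity)
  rw [Real.log_div (by positivity) hj.ne'] at h
  refine le_trans (le_of_eq ?_) h
  field_simp
  ring

theorem log_sub_log_le_one_div {j : ℝ} (hj : 0 < j) :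
    Real.log (j + 1) - Real.log j ≤ 1 / j := by
  have h := Real.log_le_sub_one_of_pos (show 0 < (j + 1) / j by positivity)
  rw [Real.log_div (by positivity) hj.ne'] at h
  refine le_trans h (le_of_eq ?_)
  field_simp
  ring

theorem harm_sub_harm_le {m : ℕ} (hm : 1 ≤ m) (n : ℕ) :
    harm (m + n) - harm m ≤ Real.log ((m : ℝ) + n) - Real.log m := by
  induction n with
  | zero => simp
  | succ n ih =>
    have h := one_div_succ_le_log_sub_log (show (0 : ℝ) < (m : ℝ) + n by positivity)
    rw [← add_assoc, harm_succ]
    push_cast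
    rw [← add_assoc]
    linarith

theorem le_harm_sub_harm (m n : ℕ) :
    Real.log ((m : ℝ) + n + 1) - Real.log ((m : ℝ) + 1) ≤ harm (m + n) - harm m := by
  induction n with
  | zero => simp
  | succ n ih =>
    have h := log_sub_log_le_one_div (show (0 : ℝ) < (m : ℝ) + n + 1 by positivity)
    rw [← add_assoc, harm_succ]
    push_cast
    rw [← add_assoc]
    linarith

theorem harm_le_one_add_log {n : ℕ} (hn : 1 ≤ n) : harm n ≤ 1 + Real.log n := by
  obtain ⟨d, rfl⟩ := Nat.exists_eq_add_of_le hn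
  have h := harm_sub_harm_le le_rfl d
  have h1 : harm 1 = 1 := by simp [harm]
  rw [h1] at h
  push_cast at h ⊢
  rw [Real.log_one] at h
  linarith

theorem logRatio_div_nonneg {x : ℝ} (h0 : 0 ≤ x) (h1 : x < 1) : 0 ≤ logRatio x / x := by
  refine div_nonneg (sub_nonneg.2 ?_) h0
  exact Real.log_le_log (by linarith) (by linarith)

/-- At `0` the quotient has the junk value `0`, which keeps it monotone. -/
theorem logRatio_div_mono {x y : ℝ} (h0 : 0 ≤ x) (hxy : x ≤ y) (h1 : y < 1) :
    logRatio x / x ≤ logRatio y / y := by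
  rcases h0.eq_or_lt with rfl | h0
  · rw [div_zero]
    exact logRatio_div_nonneg hxy h1
  -- The power series of the quotient has nonnegative coefficients, so terms compare one by one.
  · refine hasSum_le (fun n => ?_) (hasSum_logRatio_div h0 (hxy.trans_lt h1))
      (hasSum_logRatio_div (h0.trans_le hxy) h1)
    gcongr

theorem logOneAddInv_nonneg {x : ℝ} (h0 : 0 < x) : 0 ≤ logOneAddInv x :=
  sub_nonneg.2 (Real.log_le_log h0 (by linarith))

theorem logOneAddInv_anti {x y : ℝ} (h0 : 0 < x) (hxy : x ≤ y) :
    logOneAddInv y ≤ logOneAddInv x := by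
  have hy : 0 < y := h0.trans_le hxy
  have h : Real.log ((1 + y) * x) ≤ Real.log ((1 + x) * y) :=
    Real.log_le_log (by positivity) (by linarith)
  rw [Real.log_mul (by positivity) h0.ne', Real.log_mul (by positivity) hy.ne'] at h
  rw [logOneAddInv, logOneAddInv]
  linarith

theorem logRatio_div_natCast {a k : ℝ} (ha : 0 < a) (hak : a < k) :
    logRatio (a / k) / (a / k) = k * ((Real.log (k + a) - Real.log (k - a)) / a) := by
  have hk : 0 < k := ha.trans hak
  have e1 : 1 + a / k = (k + a) / k := by field_simp
  have e2 : 1 - a / k = (k - a) / k := by field_simp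
  rw [logRatio, e1, e2, Real.log_div (by positivity) hk.ne',
    Real.log_div (sub_pos.2 hak).ne' hk.ne']
  field_simp
  ring

theorem logOneAddInv_div {a k : ℝ} (ha : 0 < a) (hk : 0 < k) :
    logOneAddInv (a / k) = Real.log (a + k) - Real.log a := by
  have e1 : 1 + a / k = (a + k) / k := by field_simp; ring
  rw [logOneAddInv, e1, Real.log_div (by positivity) hk.ne', Real.log_div ha.ne' hk.ne']
  ring

/-- The summand of `harmSum`. -/
noncomputable def harmTerm (k a : ℕ) : ℝ :=
  1 / (a : ℝ) * (harm (a + k) - harm a) * (harm (k + a) - harm (k - a))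

theorem harmTerm_nonneg (k a : ℕ) : 0 ≤ harmTerm k a :=
  mul_nonneg (mul_nonneg (by positivity) (sub_nonneg.2 (harm_mono (by omega))))
    (sub_nonneg.2 (harm_mono (by omega)))

theorem harmTerm_le {a k : ℕ} (ha : 1 ≤ a) (hak : a < k) :
    harmTerm k a ≤ 1 / (k : ℝ) * (logRatio (a / k) / (a / k) * logOneAddInv (a / k)) := by
  have ha' : (0 : ℝ) < a := by positivity
  have hak' : (a : ℝ) < k := by exact_mod_cast hak
  have hk' : (0 : ℝ) < k := ha'.trans hak'
  rw [logRatio_div_natCast ha' hak', logOneAddInv_div ha' hk']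
  have h1 := harm_sub_harm_le ha k
  have h2 := harm_sub_harm_le (show 1 ≤ k - a by omega) (2 * a)
  have e2 : k - a + 2 * a = k + a := by omega
  rw [e2, Nat.cast_sub hak.le] at h2
  push_cast at h2
  rw [show (k : ℝ) - a + 2 * a = k + a by ring] at h2
  have h3 : 0 ≤ harm (k + a) - harm (k - a) := sub_nonneg.2 (harm_mono (by omega))
  have h4 : 0 ≤ harm (a + k) - harm a := sub_nonneg.2 (harm_mono (by omega))
  calc harmTerm k a
      = 1 / (a : ℝ) * ((harm (a + k) - harm a) * (harm (k + a) - harm (k - a))) := by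
        rw [harmTerm]; ring
    _ ≤ 1 / (a : ℝ) * ((Real.log ((a : ℝ) + k) - Real.log a)
          * (Real.log ((k : ℝ) + a) - Real.log ((k : ℝ) - a))) := by
        gcongr
        exact h4.trans h1
    _ = _ := by field_simp

theorem le_harmTerm {a k : ℕ} (ha : 1 ≤ a) (hak : a < k) :
    1 / ((k : ℝ) + 1) * (logRatio (((a : ℝ) - 1) / k) / (((a : ℝ) - 1) / k)
      * logOneAddInv (((a : ℝ) + 1) / k)) ≤ harmTerm k a := by
  have ha' : (1 : ℝ) ≤ a := by exact_mod_cast ha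
  have hak' : (a : ℝ) < k := by exact_mod_cast hak
  have hk' : (0 : ℝ) < k := by linarith
  -- The logarithmic lower bound for `H_{k+a} - H_{k-a}` lives at the node `a/(k+1)`; since `(a-1)/k
  -- ≤ a/(k+1)`, it can be moved to the grid of step `1/k`.
  have hmono : logRatio (((a : ℝ) - 1) / k) / (((a : ℝ) - 1) / k)
      ≤ logRatio ((a : ℝ) / (k + 1)) / ((a : ℝ) / (k + 1)) := by
    refine logRatio_div_mono (div_nonneg (by linarith) hk'.le) ?_ ?_
    · rw [div_le_div_iff₀ hk' (by linarith)]
      nlinarith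
    · rw [div_lt_one (by linarith)]
      linarith
  have h1 := le_harm_sub_harm a k
  have h2 := le_harm_sub_harm (k - a) (2 * a)
  have e2 : k - a + 2 * a = k + a := by omega
  rw [e2, Nat.cast_sub hak.le] at h2
  push_cast at h2
  rw [show (k : ℝ) - a + 2 * a + 1 = k + 1 + a by ring,
    show (k : ℝ) - a + 1 = k + 1 - a by ring] at h2
  have h4 : 0 ≤ harm (a + k) - harm a := sub_nonneg.2 (harm_mono (by omega))
  have hψ : 0 ≤ logOneAddInv (((a : ℝ) + 1) / k) := logOneAddInv_nonneg (by positivity)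
  calc _ ≤ 1 / ((k : ℝ) + 1) * (logRatio ((a : ℝ) / (k + 1)) / ((a : ℝ) / (k + 1))
          * logOneAddInv (((a : ℝ) + 1) / k)) := by gcongr
    _ = 1 / (a : ℝ) * ((Real.log ((a : ℝ) + k + 1) - Real.log ((a : ℝ) + 1))
          * (Real.log ((k : ℝ) + 1 + a) - Real.log ((k : ℝ) + 1 - a))) := by
        rw [logRatio_div_natCast (by linarith) (by linarith), logOneAddInv_div (by linarith) hk',
          show (a : ℝ) + 1 + k = a + k + 1 by ring]
        field_simp
    _ ≤ 1 / (a : ℝ) * ((harm (a + k) - harm a) * (harm (k + a) - harm (k - a))) := by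
        have : 0 ≤ Real.log ((k : ℝ) + 1 + a) - Real.log ((k : ℝ) + 1 - a) :=
          sub_nonneg.2 (Real.log_le_log (by linarith) (by linarith))
        gcongr
    _ = harmTerm k a := by rw [harmTerm]; ring

/-- Treats the last two terms `a = k - 1, k`, where the singularity of `logRatio` at `1` rules out
the comparison with the next grid point. -/
theorem harmTerm_le_of_le_succ {a k : ℕ} (hk : 2 ≤ k) (hak : k ≤ a + 1) (hak' : a ≤ k) :
    harmTerm k a ≤ 2 / k * harm (2 * k) := by
  have ha : 1 ≤ a := by omega
  have hk0 : (0 : ℝ) < k := by positivity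
  have h1 : harm (a + k) - harm a ≤ 1 := by
    rw [← sum_inv_add_eq_harm_sub]
    calc ∑ c ∈ Finset.Icc 1 k, 1 / ((a : ℝ) + c) ≤ ∑ c ∈ Finset.Icc 1 k, 1 / (k : ℝ) := by
          refine Finset.sum_le_sum fun c hc => one_div_le_one_div_of_le hk0 ?_
          have := (Finset.mem_Icc.1 hc).1
          exact_mod_cast (by omega : k ≤ a + c)
      _ = 1 := by simp [hk0.ne']
  have h2 : harm (k + a) - harm (k - a) ≤ harm (2 * k) := by
    have := harm_mono (show k + a ≤ 2 * k by omega)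
    linarith [harm_nonneg (k - a)]
  have h3 : 1 / (a : ℝ) ≤ 2 / k := by
    rw [div_le_div_iff₀ (by positivity) hk0]
    exact_mod_cast (by omega : 1 * k ≤ 2 * a)
  have h4 : 0 ≤ harm (k + a) - harm (k - a) := sub_nonneg.2 (harm_mono (by omega))
  calc harmTerm k a ≤ 2 / k * 1 * harm (2 * k) := by
        rw [harmTerm]
        gcongr
        exact sub_nonneg.2 (harm_mono (by omega))
    _ = _ := by ring

theorem sum_range_sandwich_le {φ ψ : ℕ → ℝ} {n : ℕ} {M P : ℝ}
    (hφ : ∀ i j, i ≤ j → j ≤ n + 1 → φ i ≤ φ j) (hφ0 : 0 ≤ φ 0) (hφM : φ (n + 1) ≤ M)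
    (hψ : ∀ i j, 1 ≤ i → i ≤ j → ψ j ≤ ψ i) (hψ0 : ∀ i, 1 ≤ i → 0 ≤ ψ i) (hψP : ψ 1 ≤ P) :
    ∑ i ∈ Finset.range n, (φ (i + 2) * ψ (i + 1) - φ i * ψ (i + 2)) ≤ 3 * (M * P) := by
  have hM : 0 ≤ M := (hφ0.trans (hφ 0 (n + 1) (by omega) le_rfl)).trans hφM
  have hP : 0 ≤ P := (hψ0 1 le_rfl).trans hψP
  -- The difference equals `ψ(i+1)(φ(i+2) - φ(i)) + φ(i)(ψ(i+1) - ψ(i+2))`. Once the factors are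
  -- bounded, everything telescopes: `2MP` from `φ` and `MP` from `ψ`.
  have hterm : ∀ i ∈ Finset.range n, φ (i + 2) * ψ (i + 1) - φ i * ψ (i + 2)
      ≤ P * ((φ (i + 2) - φ (i + 1)) + (φ (i + 1) - φ i)) + M * (ψ (i + 1) - ψ (i + 2)) := by
    intro i hi
    have hi' := Finset.mem_range.1 hi
    have h1 : 0 ≤ φ (i + 2) - φ i := sub_nonneg.2 (hφ _ _ (by omega) (by omega))
    have h2 : 0 ≤ ψ (i + 1) - ψ (i + 2) := sub_nonneg.2 (hψ _ _ (by omega) (by omega))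
    have h3 : ψ (i + 1) ≤ P := (hψ 1 _ le_rfl (by omega)).trans hψP
    have h4 : φ i ≤ M := (hφ i (n + 1) (by omega) le_rfl).trans hφM
    nlinarith [mul_le_mul_of_nonneg_right h3 h1, mul_le_mul_of_nonneg_right h4 h2]
  refine (Finset.sum_le_sum hterm).trans ?_
  rw [Finset.sum_add_distrib, ← Finset.mul_sum, ← Finset.mul_sum, Finset.sum_add_distrib,
    Finset.sum_range_sub (fun i => φ (i + 1)), Finset.sum_range_sub φ,
    Finset.sum_range_sub' (fun i => ψ (i + 1))]
  have h1 : 0 ≤ φ (0 + 1) := hφ0.trans (hφ _ _ (by omega) (by omega))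
  have h2 : φ n ≤ M := (hφ n (n + 1) (by omega) le_rfl).trans hφM
  have h3 := hψ0 (n + 1) (by omega)
  have h4 : P * (φ (n + 1) - φ (0 + 1) + (φ n - φ 0)) ≤ P * (2 * M) :=
    mul_le_mul_of_nonneg_left (by linarith) hP
  have h5 : M * (ψ (0 + 1) - ψ (n + 1)) ≤ M * P :=
    mul_le_mul_of_nonneg_left (by simp only [zero_add]; linarith) hM
  linarith

/-! ### Riemann sum error for the limiting integrand. -/

/-- The function whose Riemann sums approximate `harmSum`. -/
noncomputable def limitIntegrand (x : ℝ) : ℝ := logRatio x / x * logOneAddInv x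

theorem hasUnitIntegral_limitIntegrand : HasUnitIntegral limitIntegrand (21 / 8 * zetaThree) :=
  hasUnitIntegral_logRatio_mul_logOneAddInv

theorem intervalIntegrable_limitIntegrand {a b : ℝ} (h0 : 0 ≤ a) (hab : a ≤ b) (h1 : b ≤ 1) :
    IntervalIntegrable limitIntegrand MeasureTheory.volume a b := by
  rw [intervalIntegrable_iff_integrableOn_Ioo_of_le hab]
  exact hasUnitIntegral_limitIntegrand.1.mono_set (Set.Ioo_subset_Ioo h0 h1)

theorem integral_limitIntegrand :
    ∫ x in (0 : ℝ)..1, limitIntegrand x = 21 / 8 * zetaThree := by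
  rw [intervalIntegral.integral_of_le zero_le_one, MeasureTheory.integral_Ioc_eq_integral_Ioo]
  exact hasUnitIntegral_limitIntegrand.2

theorem limitIntegrand_nonneg {x : ℝ} (h0 : 0 < x) (h1 : x < 1) : 0 ≤ limitIntegrand x :=
  mul_nonneg (logRatio_div_nonneg h0.le h1) (logOneAddInv_nonneg h0)

theorem integral_limitIntegrand_le {a b : ℝ} (h0 : 0 < a) (hab : a ≤ b) (h1 : b < 1) :
    ∫ x in a..b, limitIntegrand x ≤ (b - a) * (logRatio b / b * logOneAddInv a) := by
  have h := intervalIntegral.integral_mono_on hab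
    (intervalIntegrable_limitIntegrand h0.le hab h1.le)
    (intervalIntegrable_const (c := logRatio b / b * logOneAddInv a)) fun x hx =>
      mul_le_mul (logRatio_div_mono (h0.le.trans hx.1) hx.2 h1) (logOneAddInv_anti h0 hx.1)
        (logOneAddInv_nonneg (h0.trans_le hx.1)) (logRatio_div_nonneg (h0.le.trans hab) h1)
  simpa only [intervalIntegral.integral_const, smul_eq_mul] using h

theorem le_integral_limitIntegrand {a b : ℝ} (h0 : 0 < a) (hab : a ≤ b) (h1 : b < 1) :
    (b - a) * (logRatio a / a * logOneAddInv b) ≤ ∫ x in a..b, limitIntegrand x := by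
  have h := intervalIntegral.integral_mono_on hab
    (intervalIntegrable_const (c := logRatio a / a * logOneAddInv b))
    (intervalIntegrable_limitIntegrand h0.le hab h1.le) fun x hx =>
      mul_le_mul (logRatio_div_mono h0.le hx.1 (hx.2.trans_lt h1))
        (logOneAddInv_anti (h0.trans_le hx.1) hx.2)
        (logOneAddInv_nonneg (h0.trans_le hab))
        (logRatio_div_nonneg (h0.le.trans hx.1) (hx.2.trans_lt h1))
  simpa only [intervalIntegral.integral_const, smul_eq_mul] using h

theorem integral_one_sub_log (ε : ℝ) :
    ∫ x in (0 : ℝ)..ε, 4 * (1 - Real.log x) = 4 * (2 * ε - ε * Real.log ε) := by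
  rw [intervalIntegral.integral_const_mul, intervalIntegral.integral_sub
    intervalIntegrable_const intervalIntegral.intervalIntegrable_log', integral_log]
  simp
  ring

theorem log_three_le_two : Real.log 3 ≤ 2 := by
  have := Real.log_le_sub_one_of_pos (show (0 : ℝ) < 3 by norm_num)
  linarith

theorem log_one_add_le_one {x : ℝ} (h0 : 0 < x) (h1 : x ≤ 1) : Real.log (1 + x) ≤ 1 := by
  have := Real.log_le_sub_one_of_pos (show 0 < 1 + x by linarith)
  linarith

theorem limitIntegrand_le_of_le_half {x : ℝ} (h0 : 0 < x) (h1 : x ≤ 1 / 2) :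
    limitIntegrand x ≤ 4 * (1 - Real.log x) := by
  have hφ : logRatio x / x ≤ 4 := by
    refine (logRatio_div_mono h0.le h1 (by norm_num)).trans ?_
    have e : logRatio (1 / 2) = Real.log 3 := by
      rw [logRatio, ← Real.log_div (by norm_num) (by norm_num)]
      norm_num
    rw [e]
    linarith [log_three_le_two]
  refine mul_le_mul hφ ?_ (logOneAddInv_nonneg h0) (by norm_num)
  rw [logOneAddInv]
  linarith [log_one_add_le_one h0 (by linarith)]

theorem limitIntegrand_le_of_half_le {x : ℝ} (h0 : 1 / 2 ≤ x) (h1 : x < 1) :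
    limitIntegrand x ≤ 4 * (1 - Real.log (1 - x)) := by
  have hx : 0 < x := by linarith
  have hψ : logOneAddInv x ≤ 2 := by
    refine (logOneAddInv_anti (by norm_num) h0).trans ?_
    have e : logOneAddInv (1 / 2) = Real.log 3 := by
      rw [logOneAddInv, ← Real.log_div (by norm_num) (by norm_num)]
      norm_num
    rw [e]
    exact log_three_le_two
  have hL : logRatio x ≤ 1 - Real.log (1 - x) := by
    rw [logRatio]
    linarith [log_one_add_le_one hx h1.le]
  have hL0 : 0 ≤ 1 - Real.log (1 - x) := by
    linarith [Real.log_nonpos (show 0 ≤ 1 - x by linarith) (by linarith)]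
  have hφ : logRatio x / x ≤ 2 * (1 - Real.log (1 - x)) := by
    rw [div_le_iff₀ hx]
    nlinarith
  calc limitIntegrand x ≤ 2 * (1 - Real.log (1 - x)) * 2 :=
        mul_le_mul hφ hψ (logOneAddInv_nonneg hx) (by linarith)
    _ = _ := by ring

theorem integral_limitIntegrand_left_le {ε : ℝ} (h0 : 0 < ε) (h1 : ε ≤ 1 / 2) :
    ∫ x in (0 : ℝ)..ε, limitIntegrand x ≤ 4 * (2 * ε - ε * Real.log ε) := by
  rw [← integral_one_sub_log]
  refine intervalIntegral.integral_mono_on_of_le_Ioo h0.le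
    (intervalIntegrable_limitIntegrand le_rfl h0.le (by linarith))
    ((intervalIntegrable_const.sub intervalIntegral.intervalIntegrable_log').const_mul 4)
    fun x hx => limitIntegrand_le_of_le_half hx.1 (hx.2.le.trans h1)

theorem integral_limitIntegrand_right_le {ε : ℝ} (h0 : 0 < ε) (h1 : ε ≤ 1 / 2) :
    ∫ x in (1 - ε)..1, limitIntegrand x ≤ 4 * (2 * ε - ε * Real.log ε) := by
  have e : ∫ x in (1 - ε)..1, 4 * (1 - Real.log (1 - x)) = 4 * (2 * ε - ε * Real.log ε) := by
    rw [intervalIntegral.integral_comp_sub_left (fun x => 4 * (1 - Real.log x)) 1, sub_self,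
      sub_sub_cancel, integral_one_sub_log]
  have hi : IntervalIntegrable (fun x => 4 * (1 - Real.log (1 - x))) MeasureTheory.volume
      (1 - ε) 1 := by
    have h : IntervalIntegrable (fun x => 4 * (1 - Real.log x)) MeasureTheory.volume ε 0 :=
      (intervalIntegrable_const.sub intervalIntegral.intervalIntegrable_log').const_mul 4
    simpa using h.comp_sub_left 1
  rw [← e]
  refine intervalIntegral.integral_mono_on_of_le_Ioo (by linarith)
    (intervalIntegrable_limitIntegrand (by linarith) (by linarith) le_rfl) hi
    fun x hx => limitIntegrand_le_of_half_le (by linarith [hx.1]) hx.2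

theorem integral_limitIntegrand_nonneg {a b : ℝ} (h0 : 0 ≤ a) (hab : a ≤ b) (h1 : b ≤ 1) :
    0 ≤ ∫ x in a..b, limitIntegrand x := by
  rw [intervalIntegral.integral_of_le hab, MeasureTheory.integral_Ioc_eq_integral_Ioo]
  exact MeasureTheory.setIntegral_nonneg measurableSet_Ioo fun x hx =>
    limitIntegrand_nonneg (h0.trans_lt hx.1) (hx.2.trans_le h1)

theorem sum_Icc_one_eq_sum_range (f : ℕ → ℝ) (n : ℕ) :
    ∑ a ∈ Finset.Icc 1 n, f a = ∑ i ∈ Finset.range n, f (i + 1) := by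
  induction n with
  | zero => simp
  | succ n ih => rw [Finset.sum_Icc_succ_top (by omega), ih, Finset.sum_range_succ]

theorem harmSum_eq (n : ℕ) :
    harmSum (n + 2) = ∑ i ∈ Finset.range n, harmTerm (n + 2) (i + 1)
      + harmTerm (n + 2) (n + 1) + harmTerm (n + 2) (n + 2) := by
  have h : harmSum (n + 2) = ∑ a ∈ Finset.Icc 1 (n + 2), harmTerm (n + 2) a := rfl
  rw [h, sum_Icc_one_eq_sum_range, Finset.sum_range_succ, Finset.sum_range_succ]

theorem integral_limitIntegrand_eq (n : ℕ) :
    21 / 8 * zetaThree = (∫ x in (0 : ℝ)..1 / ((n : ℝ) + 2), limitIntegrand x)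
      + ∑ i ∈ Finset.range n,
          (∫ x in (((i + 1 : ℕ) : ℝ) / ((n : ℝ) + 2))..(((i + 1 + 1 : ℕ) : ℝ) / ((n : ℝ) + 2)),
            limitIntegrand x)
      + ∫ x in (1 - 1 / ((n : ℝ) + 2))..1, limitIntegrand x := by
  have hk : (0 : ℝ) < (n : ℝ) + 2 := by positivity
  have hle : ∀ i j : ℕ, i ≤ j → (i : ℝ) / ((n : ℝ) + 2) ≤ (j : ℝ) / ((n : ℝ) + 2) :=
    fun i j hij => by gcongr
  have hle1 : ∀ i : ℕ, i ≤ n + 2 → (i : ℝ) / ((n : ℝ) + 2) ≤ 1 := fun i hi => by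
    rw [div_le_one hk]; exact_mod_cast hi
  have hii : ∀ i j : ℕ, i ≤ j → j ≤ n + 2 → IntervalIntegrable limitIntegrand MeasureTheory.volume
      ((i : ℝ) / ((n : ℝ) + 2)) ((j : ℝ) / ((n : ℝ) + 2)) := fun i j hij hj =>
    intervalIntegrable_limitIntegrand (by positivity) (hle i j hij) (hle1 j hj)
  have hsum := intervalIntegral.sum_integral_adjacent_intervals (n := n + 2)
    (a := fun i : ℕ => (i : ℝ) / ((n : ℝ) + 2)) (f := limitIntegrand)
    (μ := MeasureTheory.volume) fun i hi => hii i (i + 1) (by omega) (by omega)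
  rw [Finset.sum_range_succ, Finset.sum_range_succ'] at hsum
  have e1 : 1 - 1 / ((n : ℝ) + 2) = ((n + 1 : ℕ) : ℝ) / ((n : ℝ) + 2) := by
    push_cast; field_simp; ring
  have e2 : ((n + 2 : ℕ) : ℝ) / ((n : ℝ) + 2) = 1 := by push_cast; exact div_self hk.ne'
  simp only [e2, Nat.cast_zero, zero_div, zero_add, Nat.cast_one] at hsum
  rw [← integral_limitIntegrand, ← hsum, e1]
  ring

/-- Each term and the integral over its cell lie between the same two products of values of the
increasing `φ` and the decreasing `ψ`; the gaps telescope by `sum_range_sandwich_le`. -/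
theorem abs_sum_harmTerm_sub_le (n : ℕ) :
    |∑ i ∈ Finset.range n, harmTerm (n + 2) (i + 1) - ∑ i ∈ Finset.range n,
          (∫ x in (((i + 1 : ℕ) : ℝ) / ((n : ℝ) + 2))..(((i + 1 + 1 : ℕ) : ℝ) / ((n : ℝ) + 2)),
            limitIntegrand x)|
      ≤ 8 * (Real.log (2 * ((n : ℝ) + 2)) * Real.log (2 * ((n : ℝ) + 2))) / ((n : ℝ) + 2) := by
  set k : ℝ := (n : ℝ) + 2 with hkdef
  have hk : 2 ≤ k := by rw [hkdef]; linarith [(Nat.cast_nonneg n : (0 : ℝ) ≤ n)]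
  have hk0 : 0 < k := by linarith
  have hcast : ((n + 2 : ℕ) : ℝ) = k := by push_cast; rfl
  set φ : ℕ → ℝ := fun j => logRatio ((j : ℝ) / k) / ((j : ℝ) / k) with hφdef
  set ψ : ℕ → ℝ := fun j => logOneAddInv ((j : ℝ) / k) with hψdef
  set ℓ := Real.log (2 * k) with hℓ
  have hlt : ∀ j : ℕ, j ≤ n + 1 → (j : ℝ) / k < 1 := fun j hj => by
    have : (j : ℝ) ≤ n + 1 := by exact_mod_cast hj
    rw [div_lt_one hk0]; linarith
  have hpos : ∀ j : ℕ, 1 ≤ j → 0 < (j : ℝ) / k := fun j hj => by positivity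
  have hφ0 : ∀ j : ℕ, j ≤ n + 1 → 0 ≤ φ j := fun j hj =>
    logRatio_div_nonneg (by positivity) (hlt j hj)
  have hφm : ∀ i j : ℕ, i ≤ j → j ≤ n + 1 → φ i ≤ φ j := fun i j hij hj =>
    logRatio_div_mono (by positivity) (by gcongr) (hlt j hj)
  have hψ0 : ∀ j : ℕ, 1 ≤ j → 0 ≤ ψ j := fun j hj => logOneAddInv_nonneg (hpos j hj)
  have hψm : ∀ i j : ℕ, 1 ≤ i → i ≤ j → ψ j ≤ ψ i := fun i j hi hij =>
    logOneAddInv_anti (hpos i hi) (by gcongr)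
  have hψP : ψ 1 ≤ ℓ := by
    simp only [hψdef, Nat.cast_one]
    rw [logOneAddInv_div one_pos hk0, Real.log_one, sub_zero]
    exact Real.log_le_log (by linarith) (by linarith)
  have hℓ0 : 0 ≤ ℓ := (hψ0 1 le_rfl).trans hψP
  have hφM : φ (n + 1) ≤ 2 * ℓ := by
    simp only [hφdef]
    push_cast
    have hn1 : (0 : ℝ) < (n : ℝ) + 1 := by positivity
    rw [logRatio_div_natCast hn1 (by rw [hkdef]; linarith), mul_div_left_comm, mul_comm]
    have h1 : Real.log (k - (n + 1)) = 0 := by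
      rw [show k - ((n : ℝ) + 1) = 1 by rw [hkdef]; ring, Real.log_one]
    rw [h1, sub_zero]
    have h2 : k / ((n : ℝ) + 1) ≤ 2 := by
      rw [div_le_iff₀ hn1, hkdef]; linarith [(Nat.cast_nonneg n : (0 : ℝ) ≤ n)]
    have h3 : Real.log (k + (n + 1)) ≤ ℓ :=
      Real.log_le_log (by positivity) (by rw [hkdef]; linarith)
    have h4 : 0 ≤ k / ((n : ℝ) + 1) := by positivity
    nlinarith
  have hsand := sum_range_sandwich_le hφm (hφ0 0 (by omega)) hφM hψm hψ0 hψP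
  have hlow : ∀ i, i < n → 1 / (k + 1) * (φ i * ψ (i + 2)) ≤ harmTerm (n + 2) (i + 1) := by
    intro i hi
    have h := le_harmTerm (show 1 ≤ i + 1 by omega) (show i + 1 < n + 2 by omega)
    have e1 : ((i + 1 : ℕ) : ℝ) - 1 = i := by push_cast; ring
    have e2 : ((i + 1 : ℕ) : ℝ) + 1 = ((i + 2 : ℕ) : ℝ) := by push_cast; ring
    rwa [hcast, e1, e2] at h
  have hup : ∀ i, i < n → harmTerm (n + 2) (i + 1) ≤ 1 / k * (φ (i + 2) * ψ (i + 1)) := by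
    intro i hi
    have h := harmTerm_le (show 1 ≤ i + 1 by omega) (show i + 1 < n + 2 by omega)
    rw [hcast] at h
    refine h.trans ?_
    have := hφm (i + 1) (i + 2) (by omega) (by omega)
    exact mul_le_mul_of_nonneg_left (mul_le_mul_of_nonneg_right this (hψ0 _ (by omega)))
      (by positivity)
  have hgap : ∀ i : ℕ, ((i + 1 + 1 : ℕ) : ℝ) / k - ((i + 1 : ℕ) : ℝ) / k = 1 / k := fun i => by
    push_cast; ring
  have hIup : ∀ i, i < n → ∫ x in (((i + 1 : ℕ) : ℝ) / k)..(((i + 1 + 1 : ℕ) : ℝ) / k),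
      limitIntegrand x ≤ 1 / k * (φ (i + 2) * ψ (i + 1)) := by
    intro i hi
    have h := integral_limitIntegrand_le (hpos (i + 1) (by omega))
      (show ((i + 1 : ℕ) : ℝ) / k ≤ ((i + 1 + 1 : ℕ) : ℝ) / k by gcongr; omega)
      (hlt (i + 1 + 1) (by omega))
    rwa [hgap] at h
  have hIlow : ∀ i, i < n → 1 / (k + 1) * (φ i * ψ (i + 2))
      ≤ ∫ x in (((i + 1 : ℕ) : ℝ) / k)..(((i + 1 + 1 : ℕ) : ℝ) / k), limitIntegrand x := by
    intro i hi
    have h := le_integral_limitIntegrand (hpos (i + 1) (by omega))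
      (show ((i + 1 : ℕ) : ℝ) / k ≤ ((i + 1 + 1 : ℕ) : ℝ) / k by gcongr; omega)
      (hlt (i + 1 + 1) (by omega))
    rw [hgap] at h
    refine le_trans (mul_le_mul (one_div_le_one_div_of_le hk0 (by linarith))
      (mul_le_mul_of_nonneg_right (hφm i (i + 1) (by omega) (by omega)) (hψ0 _ (by omega)))
      (mul_nonneg (hφ0 i (by omega)) (hψ0 _ (by omega))) (by positivity)) h
  rw [← Finset.sum_sub_distrib]
  refine (Finset.abs_sum_le_sum_abs _ _).trans ?_
  -- The second summand pays for `1/(k+1)` in the lower bound in place of `1/k`. Over all cells the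
  -- two summands give `(6 + 2) ℓ²/k`.
  have hterm : ∀ i ∈ Finset.range n, |harmTerm (n + 2) (i + 1)
      - ∫ x in (((i + 1 : ℕ) : ℝ) / k)..(((i + 1 + 1 : ℕ) : ℝ) / k), limitIntegrand x|
      ≤ 1 / k * (φ (i + 2) * ψ (i + 1) - φ i * ψ (i + 2)) + 1 / (k * k) * (2 * ℓ * ℓ) := by
    intro i hi
    have hi' := Finset.mem_range.1 hi
    have hprod : φ i * ψ (i + 2) ≤ 2 * ℓ * ℓ :=
      mul_le_mul ((hφm i (n + 1) (by omega) le_rfl).trans hφM)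
        ((hψm 1 _ le_rfl (by omega)).trans hψP) (hψ0 _ (by omega)) (by positivity)
    have hprod0 : 0 ≤ φ i * ψ (i + 2) := mul_nonneg (hφ0 i (by omega)) (hψ0 _ (by omega))
    have hdiff : 1 / k - 1 / (k + 1) ≤ 1 / (k * k) := by
      rw [div_sub_div _ _ hk0.ne' (by linarith), div_le_div_iff₀ (by positivity) (by positivity)]
      nlinarith
    have hdiff0 : (1 / k - 1 / (k + 1)) * (φ i * ψ (i + 2)) ≤ 1 / (k * k) * (2 * ℓ * ℓ) :=
      mul_le_mul hdiff hprod hprod0 (by positivity)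
    have h1 := hlow i hi'
    have h2 := hup i hi'
    have h3 := hIlow i hi'
    have h4 := hIup i hi'
    have e1 : 1 / k * (φ (i + 2) * ψ (i + 1) - φ i * ψ (i + 2))
        = 1 / k * (φ (i + 2) * ψ (i + 1)) - 1 / k * (φ i * ψ (i + 2)) := by ring
    rw [sub_mul] at hdiff0
    rw [e1, abs_le]
    constructor <;> linarith
  refine (Finset.sum_le_sum hterm).trans ?_
  rw [Finset.sum_add_distrib, ← Finset.mul_sum, Finset.sum_const, Finset.card_range, nsmul_eq_mul]
  have h1 : 1 / k * ∑ i ∈ Finset.range n, (φ (i + 2) * ψ (i + 1) - φ i * ψ (i + 2))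
      ≤ 1 / k * (3 * (2 * ℓ * ℓ)) := mul_le_mul_of_nonneg_left hsand (by positivity)
  have h2 : (n : ℝ) * (1 / (k * k) * (2 * ℓ * ℓ)) ≤ k * (1 / (k * k) * (2 * ℓ * ℓ)) :=
    mul_le_mul_of_nonneg_right (by rw [hkdef]; linarith) (by positivity)
  refine (add_le_add h1 h2).trans (le_of_eq ?_)
  field_simp
  ring

/-! ### Assembling the error bounds. -/

theorem one_le_log_natCast {k : ℕ} (hk : 3 ≤ k) : 1 ≤ Real.log k := by
  have hk' : (3 : ℝ) ≤ k := by exact_mod_cast hk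
  rw [Real.le_log_iff_exp_le (by linarith)]
  linarith [Real.exp_one_lt_three]

theorem log_two_mul_natCast_le {k : ℕ} (hk : 3 ≤ k) : Real.log (2 * k) ≤ 2 * Real.log k := by
  have hk' : (3 : ℝ) ≤ k := by exact_mod_cast hk
  rw [← Real.log_rpow (by linarith)]
  refine Real.log_le_log (by linarith) ?_
  norm_num
  nlinarith

theorem abs_harmSum_sub_le {k : ℕ} (hk : 3 ≤ k) :
    |harmSum k - 21 / 8 * zetaThree| ≤ 68 * Real.log k ^ 2 / k := by
  have hℓ := one_le_log_natCast hk
  have hℓ2 := log_two_mul_natCast_le hk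
  have hk' : (3 : ℝ) ≤ k := by exact_mod_cast hk
  have hH : harm (2 * k) ≤ 3 * Real.log k := by
    have := harm_le_one_add_log (show 1 ≤ 2 * k by omega)
    push_cast at this
    linarith
  obtain ⟨n, rfl⟩ := Nat.exists_eq_add_of_le' (show 2 ≤ k by omega)
  have hcast : ((n + 2 : ℕ) : ℝ) = (n : ℝ) + 2 := by push_cast; rfl
  have hmid := abs_sum_harmTerm_sub_le n
  have ht1 := harmTerm_le_of_le_succ (a := n + 1) (k := n + 2) (by omega) (by omega) (by omega)
  have ht2 := harmTerm_le_of_le_succ (a := n + 2) (k := n + 2) (by omega) (by omega) (by omega)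
  have ht1' := harmTerm_nonneg (n + 2) (n + 1)
  have ht2' := harmTerm_nonneg (n + 2) (n + 2)
  rw [harmSum_eq, integral_limitIntegrand_eq n]
  rw [hcast] at hℓ hℓ2 hk' hH ht1 ht2 ⊢
  set k : ℝ := (n : ℝ) + 2
  have hk0 : 0 < k := by linarith
  have hε : 1 / k ≤ 1 / 2 := one_div_le_one_div_of_le (by norm_num) (by linarith)
  have hε0 : 0 < 1 / k := by positivity
  have hl := integral_limitIntegrand_left_le hε0 hε
  have hr := integral_limitIntegrand_right_le hε0 hε
  have hl' := integral_limitIntegrand_nonneg le_rfl hε0.le (by linarith)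
  have hr' := integral_limitIntegrand_nonneg (show 0 ≤ 1 - 1 / k by linarith) (by linarith) le_rfl
  rw [one_div k, Real.log_inv, ← one_div] at hl hr
  set ℓ := Real.log k
  have hmid' : 8 * (Real.log (2 * k) * Real.log (2 * k)) / k ≤ 32 * (ℓ ^ 2 / k) := by
    have h0 : 0 ≤ Real.log (2 * k) := Real.log_nonneg (by linarith)
    rw [mul_div_assoc', div_le_div_iff_of_pos_right hk0]
    nlinarith
  have hsq : 1 / k * ℓ ≤ ℓ ^ 2 / k := by
    rw [one_div_mul_eq_div, div_le_div_iff_of_pos_right hk0]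
    nlinarith
  have hsq1 : 1 / k ≤ 1 / k * ℓ := le_mul_of_one_le_right hε0.le hℓ
  have hend : 2 / k * harm (2 * (n + 2)) ≤ 6 * (1 / k * ℓ) := by
    calc 2 / k * harm (2 * (n + 2)) ≤ 2 / k * (3 * ℓ) :=
          mul_le_mul_of_nonneg_left hH (by positivity)
      _ = _ := by ring
  -- `68 = 32 + 2·12 + 2·6`: the middle cells, the two end strips of the integral, and the last two
  -- terms of the sum.
  rw [mul_div_assoc]
  rw [abs_le] at hmid ⊢
  constructor <;> linarith [hmid.1, hmid.2]

theorem theorem4p8 :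
    (fun k : ℕ =>
      (∑ m₁ ∈ Finset.Icc 1 k, ∑ m₂ ∈ Finset.Icc 1 k, ∑ m₃ ∈ Finset.Icc 1 k,
          1 / (((m₁ : ℝ) + (m₂ : ℝ)) * ((m₂ : ℝ) + (m₃ : ℝ)) * ((m₃ : ℝ) + (m₁ : ℝ))))
        - ((3 / 2 : ℝ) * (riemannZeta 2).re * (∑ m ∈ Finset.Icc 1 k, 1 / (m : ℝ))
            - (41 / 8 : ℝ) * (riemannZeta 3).re))
      =O[atTop] (fun k : ℕ => (Real.log (k : ℝ)) ^ 3 / (k : ℝ)) := by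
  -- `13/2 · 2 + 5/2 + 68 ≤ 84`; from `k = 3` on, `log k ≥ 1`, so lower powers of `log k` are
  -- absorbed.
  refine IsBigO.of_bound 84 (eventually_atTop.2 ⟨3, fun k hk => ?_⟩)
  have hℓ := one_le_log_natCast hk
  have hk0 : (0 : ℝ) < k := by have : (3 : ℝ) ≤ k := by exact_mod_cast hk
                               linarith
  have h1 := abs_sum_cube_sub_le (show 1 ≤ k by omega)
  have h2 := abs_harmSum_sub_le hk
  have hH : harm k ≤ 2 * Real.log k := by
    have := harm_le_one_add_log (show 1 ≤ k by omega)
    linarith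
  rw [Real.norm_eq_abs, Real.norm_of_nonneg (by positivity)]
  refine h1.trans ((add_le_add_right h2 _).trans ?_)
  rw [mul_one_div, ← add_div, ← add_div, mul_div_assoc', div_le_div_iff_of_pos_right hk0]
  have h3 : Real.log k ≤ Real.log k ^ 3 := le_self_pow₀ hℓ (by norm_num)
  have h4 : Real.log k ^ 2 ≤ Real.log k ^ 3 := pow_le_pow_right₀ hℓ (by norm_num)
  linarith
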